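/- There is a deterministic algorithm with the following property. For $k\ge 1$ let $\Delta^k=\{u\in\mathbb R^k_{\ge 0}:\sum_{i=1}^k u_i=1\}$. The algorithm is given integers $m,n\ge 1$, a number $\epsilon>0$, and access to an unknown matrix $A\in\mathbb R^{m\times n}$ with $\|A\|_{\max}=\max_{i,j}|A_{ij}|\le 1$ only through a matrix-vector oracle, which when queried (adaptively) at any $(x,y)\in\mathbb R^n\times\mathbb R^m$ returns $(Ax,A^\top y)$. It outputs an $\epsilon$-solution ($\epsilon$-saddle point) of the zero-sum game $\min_{x\in\Delta^n}\max_{y\in\Delta^m}y^\top Ax$, that is, a pair $(x,y)\in\Delta^n\times\Delta^m$ with $$\max_{y'\in\Delta^m}(y')^\top Ax-\min_{x'\in\Delta^n}y^\top Ax'\le\epsilon,$$ and it makes $\tilde O(\epsilon^{-8/9})$ oracle queries, where $\tilde O$ hides polylogarithmic factors in $m$, $n$ and $\epsilon^{-1}$: there are absolute constants $C>0$ and $k\in\mathbb N$, independent of $m,n,\epsilon,A$, such that the number of queries is at most $C\,\epsilon^{-8/9}\,\bigl(\log(m+n+\epsilon^{-1})\bigr)^k$. (The complexity is the information-theoretic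 query complexity: a deterministic algorithm is any deterministic adaptive rule that determines the next query, or the decision to stop and the output, from $m,n,\epsilon$ and the answers received so far.) -/

import Mathlib

open scoped Matrix

/-- A deterministic algorithm with matrix-vector oracle access to an unknown `m × n` real matrix,
returning a value of type `α`.  It either stops with an output, or queries a pair
`(x, y) ∈ ℝⁿ × ℝᵐ` and continues in a way that may depend arbitrarily on the answer
`(u, v) ∈ ℝᵐ × ℝⁿ` (hence, through the nesting, on all the earlier answers). -/
inductive MatVecAlg (m n : ℕ) (α : Type) : Type
  | output (a : α) : MatVecAlg m n α
  | query (x : Fin n → ℝ) (y : Fin m → ℝ)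
      (cont : (Fin m → ℝ) → (Fin n → ℝ) → MatVecAlg m n α) : MatVecAlg m n α

namespace MatVecAlg

variable {m n : ℕ} {α : Type}

/-- The output of the algorithm when the oracle answers for the matrix `A`,
that is, answers the query `(x, y)` by `(A x, Aᵀ y)`. -/
def result (A : Matrix (Fin m) (Fin n) ℝ) : MatVecAlg m n α → α
  | output a => a
  | query x y cont => result A (cont (A *ᵥ x) (Aᵀ *ᵥ y))

/-- The number of matrix-vector queries that the algorithm makes when the oracle
answers for the matrix `A`. -/
def numQueries (A : Matrix (Fin m) (Fin n) ℝ) : MatVecAlg m n α → ℕ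
  | output _ => 0
  | query x y cont => numQueries A (cont (A *ᵥ x) (Aᵀ *ᵥ y)) + 1

end MatVecAlg

/-- The bilinear form `f_A(x, y) = yᵀ A x`. -/
def bilin {m n : ℕ} (A : Matrix (Fin m) (Fin n) ℝ) (x : Fin n → ℝ) (y : Fin m → ℝ) : ℝ :=
  y ⬝ᵥ (A *ᵥ x)

/-- The gap of `(x, y)` for the problem `min_{x ∈ X} max_{y ∈ Y} f(x, y)`:
`max_{y' ∈ Y} f(x, y') - min_{x' ∈ X} f(x', y)`.  It is used for continuous `f` and nonempty
compact `X`, `Y`, where the supremum and the infimum are attained. -/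
noncomputable def saddleGap {E F : Type*} (X : Set E) (Y : Set F) (f : E → F → ℝ) (z : E × F) : ℝ :=
  sSup ((fun y' => f z.1 y') '' Y) - sInf ((fun x' => f x' z.2) '' X)

/-- `z = (x, y)` is an `ε`-solution (an `ε`-saddle point) of `min_{x ∈ X} max_{y ∈ Y} f(x, y)`. -/
def IsEpsSolution {E F : Type*} (X : Set E) (Y : Set F) (f : E → F → ℝ) (ε : ℝ) (z : E × F) : Prop :=
  z.1 ∈ X ∧ z.2 ∈ Y ∧ saddleGap X Y f z ≤ ε

/-!
An accuracy of order `ε` is reached with about `ε ^ (-4 / 5)` queries, up to logarithms, which is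
below the required `ε ^ (-8 / 9)`.

*Symmetrization.*  If both players of the game `A` choose a column and a row and play `A` once in
each role, the result is a symmetric game on joint strategies `z ∈ Δ^(n × m)` with a skew payoff
matrix `S`.  A single query at the marginals of `z` reveals `S z`, and the duality gap of the
marginals is, up to the scaling, the largest value of `-(S z) ⬝ᵥ u` over strategies `u`
(`isEpsSolution_marginals`).

*Proximal steps with a learned model.*  The method is an entropic extragradient method which keeps
a center `c` and a model `N` of `S`, both known, so that computations with `N` need no query.  From
`S c`, an exact proximal step `z` for the model payoff `S c + N (z - c)` is computed, with a
regularization `lam ≥ α`.  It exists because the model is skew (`exists_gibbs_fixedPoint`), and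
`lam` can be chosen such that `KL(z ‖ c) ≤ r²`, with equality unless `lam = α`
(`exists_proximal_step`).  The error of the model at `z` is `h = (S - N) (z - c)`.

If the second moment of `h` under `z` is small compared to `lam² KL(z ‖ c)`, then the mirror step
from `c` along `S z` stays close to `z`, and the three-point identity gives the regret bound of the
proximal point method for `z`, less a multiple of `KL(z ‖ c)`.  So the accepted steps have a total
length `∑ KL(z ‖ c) ≤ 2 log |ι|`, which allows few steps with `KL(z ‖ c) = r²`; the others have
`lam = α`, and about `α log |ι| / ε` of them suffice for accuracy `ε` of the weighted mean of the
points `z` (`Invariant.mean_spec`).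

Otherwise `S - N` is large, in the local norm given by weights near `c`, in the direction `z - c`,
and projecting the error away reduces the weighted squared Frobenius norm of `S - N` by at least
`lam² / 16` (`weightedSq_correctModel_le`).  This potential is at most `4` for all weights, and since
the entries of `S - N` are bounded (the model is clipped to `[-1, 1]`), a move of the weights by `d`
in the `ℓ¹` norm changes it by at most `8 d` (`weightedSq_le_add`), where `d = O(r)` by Pinsker's
inequality.  With `r = α² / 512`, moves cost less than corrections gain, and the number of
corrections is at most of the order of `α⁻²` plus the number of accepted steps
(`Invariant.next`).  The choice `α = ε ^ (1 / 5)` balances the numbers `α / ε` and `r⁻²` of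
accepted steps (`numIter_le`).
-/

namespace SkewGame

/-! ### Relative entropy and Gibbs reweighting -/

section Entropy

variable {ι : Type*} [Fintype ι]

/-- The relative entropy `KL(u ‖ c) = ∑ᵢ uᵢ log (uᵢ / cᵢ)` of finite vectors. -/
noncomputable def relEntropy (u c : ι → ℝ) : ℝ := ∑ i, u i * Real.log (u i / c i)

/-- The Gibbs reweighting of `c` by the cost `p`, with coordinates proportional to
`cᵢ exp (-pᵢ)`. -/
noncomputable def gibbs (c p : ι → ℝ) : ι → ℝ :=
  fun i => c i * Real.exp (-p i) / ∑ j, c j * Real.exp (-p j)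

lemma sq_sub_div_le_mul_log {a b : ℝ} (ha : 0 ≤ a) (hb : 0 < b) :
    (a - b) ^ 2 / (2 * (a + b)) ≤ a * Real.log (a / b) - a + b := by
  rcases ha.eq_or_lt with rfl | ha
  · simp only [zero_sub, zero_add, zero_mul, neg_zero]
    rw [div_le_iff₀ (by positivity)]; nlinarith
  obtain ⟨s, hs, rfl⟩ : ∃ s : ℝ, 0 < s ∧ a = s ^ 2 := ⟨√a, by positivity, (Real.sq_sqrt ha.le).symm⟩
  obtain ⟨t, ht, rfl⟩ : ∃ t : ℝ, 0 < t ∧ b = t ^ 2 := ⟨√b, by positivity, (Real.sq_sqrt hb.le).symm⟩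
  -- `log x ≤ x - 1` at `x = t / s` bounds the right-hand side below by `(s - t)²`.
  have h := Real.log_le_sub_one_of_pos (show 0 < t / s by positivity)
  have hl : Real.log (s ^ 2 / t ^ 2) = -2 * Real.log (t / s) := by
    rw [← div_pow, Real.log_pow, ← inv_div t s, Real.log_inv]; push_cast; ring
  have h2 : s ^ 2 * Real.log (t / s) ≤ s * t - s ^ 2 := by
    calc s ^ 2 * Real.log (t / s) ≤ s ^ 2 * (t / s - 1) := by gcongr
      _ = s * t - s ^ 2 := by field_simp
  rw [hl, div_le_iff₀ (by positivity)]
  have h3 : (s - t) ^ 2 ≤ s ^ 2 * (-2 * Real.log (t / s)) - s ^ 2 + t ^ 2 := by nlinarith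
  have h4 : (s ^ 2 - t ^ 2) ^ 2 ≤ (s - t) ^ 2 * (2 * (s ^ 2 + t ^ 2)) := by
    nlinarith [mul_nonneg (sq_nonneg (s - t)) (sq_nonneg (s - t))]
  exact h4.trans (by gcongr)

lemma sum_sq_sub_div_le_relEntropy {u c : ι → ℝ} (hu : u ∈ stdSimplex ℝ ι)
    (hc : c ∈ stdSimplex ℝ ι) (hc0 : ∀ i, 0 < c i) :
    ∑ i, (u i - c i) ^ 2 / (2 * (u i + c i)) ≤ relEntropy u c := by
  calc _ ≤ ∑ i, (u i * Real.log (u i / c i) - u i + c i) :=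
        Finset.sum_le_sum fun i _ => sq_sub_div_le_mul_log (hu.1 i) (hc0 i)
    _ = relEntropy u c := by
        rw [Finset.sum_add_distrib, Finset.sum_sub_distrib, hu.2, hc.2, relEntropy]; ring

lemma relEntropy_nonneg {u c : ι → ℝ} (hu : u ∈ stdSimplex ℝ ι)
    (hc : c ∈ stdSimplex ℝ ι) (hc0 : ∀ i, 0 < c i) : 0 ≤ relEntropy u c :=
  (Finset.sum_nonneg fun i _ => div_nonneg (sq_nonneg _)
    (by linarith [hu.1 i, hc0 i])).trans (sum_sq_sub_div_le_relEntropy hu hc hc0)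

/-- A form of Pinsker's inequality. -/
lemma sum_abs_sub_sq_le {u c : ι → ℝ} (hu : u ∈ stdSimplex ℝ ι)
    (hc : c ∈ stdSimplex ℝ ι) (hc0 : ∀ i, 0 < c i) :
    (∑ i, |u i - c i|) ^ 2 ≤ 4 * relEntropy u c := by
  have h : (∑ i, |u i - c i|) ^ 2 ≤
      (∑ i, (u i - c i) ^ 2 / (2 * (u i + c i))) * ∑ i, 2 * (u i + c i) := by
    refine Finset.sum_sq_le_sum_mul_sum_of_sq_le_mul _ (fun i _ => ?_) (fun i _ => ?_)
      (fun i _ => ?_)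
    · exact div_nonneg (sq_nonneg _) (by linarith [hu.1 i, hc0 i])
    · linarith [hu.1 i, hc0 i]
    · rw [sq_abs, div_mul_cancel₀]
      linarith [hu.1 i, hc0 i]
  rw [← Finset.mul_sum, Finset.sum_add_distrib, hu.2, hc.2] at h
  linarith [sum_sq_sub_div_le_relEntropy hu hc hc0]

lemma sum_abs_sub_le {u c : ι → ℝ} (hu : u ∈ stdSimplex ℝ ι)
    (hc : c ∈ stdSimplex ℝ ι) (hc0 : ∀ i, 0 < c i) {r : ℝ} (hr : 0 ≤ r)
    (h : relEntropy u c ≤ r ^ 2) : ∑ i, |u i - c i| ≤ 2 * r := by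
  refine le_of_sq_le_sq ?_ (by positivity)
  linarith [sum_abs_sub_sq_le hu hc hc0]

lemma eq_of_relEntropy_le_zero {u c : ι → ℝ} (hu : u ∈ stdSimplex ℝ ι)
    (hc : c ∈ stdSimplex ℝ ι) (hc0 : ∀ i, 0 < c i) (h : relEntropy u c ≤ 0) : u = c := by
  have h1 := sum_abs_sub_le hu hc hc0 le_rfl (r := 0) (h.trans_eq (by norm_num))
  funext i
  have h2 := Finset.single_le_sum (f := fun i => |u i - c i|) (fun i _ => abs_nonneg _)
    (Finset.mem_univ i)
  have h3 : |u i - c i| ≤ 0 := h2.trans (by linarith)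
  linarith [abs_nonpos_iff.1 h3]

lemma relEntropy_self {c : ι → ℝ} (hc0 : ∀ i, 0 < c i) : relEntropy c c = 0 :=
  Finset.sum_eq_zero fun i _ => by rw [div_self (hc0 i).ne', Real.log_one, mul_zero]

lemma relEntropy_eq {u c : ι → ℝ} (hc0 : ∀ i, 0 < c i) :
    relEntropy u c = ∑ i, (u i * Real.log (u i) - u i * Real.log (c i)) := by
  refine Finset.sum_congr rfl fun i _ => ?_
  rcases eq_or_ne (u i) 0 with h | h
  · simp [h]
  · rw [Real.log_div h (hc0 i).ne']; ring

lemma continuous_relEntropy {c : ι → ℝ} (hc0 : ∀ i, 0 < c i) :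
    Continuous fun u => relEntropy u c := by
  simp_rw [relEntropy_eq hc0]
  refine continuous_finsetSum _ fun i _ => Continuous.sub ?_ (by fun_prop)
  exact Real.continuous_mul_log.comp (continuous_apply i)

lemma relEntropy_segment_le {u v c : ι → ℝ} (hc0 : ∀ i, 0 < c i) (hu : ∀ i, 0 ≤ u i)
    (hv : ∀ i, 0 ≤ v i) {s : ℝ} (hs0 : 0 ≤ s) (hs1 : s ≤ 1) :
    relEntropy (u + s • (v - u)) c ≤ (1 - s) * relEntropy u c + s * relEntropy v c := by
  simp_rw [relEntropy_eq hc0, Finset.mul_sum, ← Finset.sum_add_distrib]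
  refine Finset.sum_le_sum fun i _ => ?_
  have h := Real.convexOn_mul_log.2 (hu i) (hv i) (sub_nonneg.2 hs1) hs0 (by ring)
  simp only [smul_eq_mul] at h
  have e : (u + s • (v - u)) i = (1 - s) * u i + s * v i := by
    simp only [Pi.add_apply, Pi.smul_apply, Pi.sub_apply, smul_eq_mul]; ring
  rw [e]
  nlinarith

/-- The relative entropy to the uniform distribution is at most `log |ι|`. -/
lemma relEntropy_uniform_le [Nonempty ι] {u : ι → ℝ} (hu : u ∈ stdSimplex ℝ ι) :
    relEntropy u (fun _ => (Fintype.card ι : ℝ)⁻¹) ≤ Real.log (Fintype.card ι) := by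
  have hN : (0 : ℝ) < Fintype.card ι := by exact_mod_cast Fintype.card_pos
  rw [relEntropy_eq (fun _ => by positivity), Finset.sum_sub_distrib, ← Finset.sum_mul, hu.2,
    Real.log_inv]
  have h : ∑ i, u i * Real.log (u i) ≤ 0 := Finset.sum_nonpos fun i _ =>
    Real.mul_log_nonpos (hu.1 i)
      (hu.2 ▸ Finset.single_le_sum (fun j _ => hu.1 j) (Finset.mem_univ i))
  linarith

section Gibbs

variable [Nonempty ι]

lemma gibbs_sum_pos {c : ι → ℝ} (hc0 : ∀ i, 0 < c i) (p : ι → ℝ) :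
    0 < ∑ j, c j * Real.exp (-p j) :=
  Finset.sum_pos (fun j _ => mul_pos (hc0 j) (Real.exp_pos _)) Finset.univ_nonempty

lemma gibbs_pos {c : ι → ℝ} (hc0 : ∀ i, 0 < c i) (p : ι → ℝ) (i : ι) : 0 < gibbs c p i :=
  div_pos (mul_pos (hc0 i) (Real.exp_pos _)) (gibbs_sum_pos hc0 p)

lemma gibbs_mem {c : ι → ℝ} (hc0 : ∀ i, 0 < c i) (p : ι → ℝ) :
    gibbs c p ∈ stdSimplex ℝ ι := by
  refine ⟨fun i => (gibbs_pos hc0 p i).le, ?_⟩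
  simp only [gibbs]
  rw [← Finset.sum_div, div_self (gibbs_sum_pos hc0 p).ne']

lemma gibbs_gibbs {c : ι → ℝ} (hc0 : ∀ i, 0 < c i) (p q : ι → ℝ) :
    gibbs (gibbs c p) q = gibbs c (p + q) := by
  have hp := gibbs_sum_pos hc0 p
  have h (i : ι) : gibbs c p i * Real.exp (-q i) =
      c i * Real.exp (-(p + q) i) / ∑ j, c j * Real.exp (-p j) := by
    rw [gibbs, Pi.add_apply, neg_add, Real.exp_add]; ring
  funext i
  rw [gibbs]
  simp_rw [h]
  rw [← Finset.sum_div, div_div_div_cancel_right₀ hp.ne', gibbs]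

lemma relEntropy_gibbs {c : ι → ℝ} (hc0 : ∀ i, 0 < c i) (p : ι → ℝ) {u : ι → ℝ}
    (hu : u ∈ stdSimplex ℝ ι) :
    relEntropy u (gibbs c p) =
      relEntropy u c + p ⬝ᵥ u + Real.log (∑ j, c j * Real.exp (-p j)) := by
  have hl (i : ι) : Real.log (gibbs c p i) =
      Real.log (c i) - p i - Real.log (∑ j, c j * Real.exp (-p j)) := by
    rw [gibbs, Real.log_div (mul_pos (hc0 i) (Real.exp_pos _)).ne' (gibbs_sum_pos hc0 p).ne',
      Real.log_mul (hc0 i).ne' (Real.exp_pos _).ne', Real.log_exp]; ring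
  rw [relEntropy_eq (gibbs_pos hc0 p), relEntropy_eq hc0, dotProduct]
  have : Real.log (∑ j, c j * Real.exp (-p j)) =
      ∑ i, u i * Real.log (∑ j, c j * Real.exp (-p j)) := by
    rw [← Finset.sum_mul, hu.2, one_mul]
  rw [this, ← Finset.sum_add_distrib, ← Finset.sum_add_distrib]
  refine Finset.sum_congr rfl fun i _ => ?_
  rw [hl]; ring

/-- The three-point identity of entropic mirror descent. -/
lemma dotProduct_gibbs_sub {c : ι → ℝ} (hc0 : ∀ i, 0 < c i)
    (p : ι → ℝ) {u : ι → ℝ} (hu : u ∈ stdSimplex ℝ ι) :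
    p ⬝ᵥ (gibbs c p - u) =
      relEntropy u c - relEntropy u (gibbs c p) - relEntropy (gibbs c p) c := by
  have h1 := relEntropy_gibbs hc0 p hu
  have h2 := relEntropy_gibbs hc0 p (gibbs_mem hc0 p)
  have h3 := relEntropy_self (gibbs_pos hc0 p)
  rw [dotProduct_sub]
  linarith

lemma log_sum_mul_exp_neg_add {c : ι → ℝ} (hc0 : ∀ i, 0 < c i) (p q : ι → ℝ) :
    Real.log (∑ j, c j * Real.exp (-(p + q) j)) =
      Real.log (∑ j, c j * Real.exp (-p j)) + Real.log (∑ j, gibbs c p j * Real.exp (-q j)) := by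
  have hp := gibbs_sum_pos hc0 p
  rw [← Real.log_mul hp.ne' (gibbs_sum_pos (gibbs_pos hc0 p) q).ne', Finset.mul_sum]
  congr 1
  refine Finset.sum_congr rfl fun j _ => ?_
  rw [gibbs, Pi.add_apply, neg_add, Real.exp_add]
  field_simp

lemma log_sum_mul_exp_neg_le {c : ι → ℝ} (hc : c ∈ stdSimplex ℝ ι) (hc0 : ∀ i, 0 < c i)
    {q : ι → ℝ} (hq : ∀ i, |q i| ≤ 1) :
    Real.log (∑ j, c j * Real.exp (-q j)) ≤ -(q ⬝ᵥ c) + ∑ j, c j * q j ^ 2 := by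
  have h := Real.log_le_sub_one_of_pos (gibbs_sum_pos hc0 q)
  have h2 : ∑ j, c j * Real.exp (-q j) ≤ ∑ j, c j * (1 - q j + q j ^ 2) := by
    refine Finset.sum_le_sum fun j _ => mul_le_mul_of_nonneg_left ?_ (hc0 j).le
    have := Real.abs_exp_sub_one_sub_id_le (x := -q j) (by rw [abs_neg]; exact hq j)
    rw [neg_sq] at this
    linarith [(abs_le.1 this).2]
  have h3 : ∑ j, c j * (1 - q j + q j ^ 2) = 1 - q ⬝ᵥ c + ∑ j, c j * q j ^ 2 := by
    simp_rw [mul_add, mul_sub, Finset.sum_add_distrib, Finset.sum_sub_distrib, mul_one, hc.2,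
      dotProduct, mul_comm]
  linarith

/-- A small tilt `q` moves a distribution by at most the second moment of `q`. -/
lemma relEntropy_gibbs_self_le {c : ι → ℝ} (hc : c ∈ stdSimplex ℝ ι) (hc0 : ∀ i, 0 < c i)
    {q : ι → ℝ} (hq : ∀ i, |q i| ≤ 1) :
    relEntropy c (gibbs c q) ≤ ∑ j, c j * q j ^ 2 := by
  rw [relEntropy_gibbs hc0 q hc, relEntropy_self hc0]
  linarith [log_sum_mul_exp_neg_le hc hc0 hq]

end Gibbs

end Entropy

/-! ### Proximal steps of skew games -/

section Proximal

variable {ι : Type*} [Fintype ι]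

lemma skew_dotProduct {N : Matrix ι ι ℝ} (hN : Nᵀ = -N) (u v : ι → ℝ) :
    (N *ᵥ u) ⬝ᵥ v = -((N *ᵥ v) ⬝ᵥ u) := by
  rw [dotProduct_comm, Matrix.dotProduct_mulVec, ← Matrix.mulVec_transpose, hN, Matrix.neg_mulVec,
    neg_dotProduct]

lemma skew_dotProduct_self {N : Matrix ι ι ℝ} (hN : Nᵀ = -N) (u : ι → ℝ) :
    (N *ᵥ u) ⬝ᵥ u = 0 := by
  linarith [skew_dotProduct hN u u]

lemma abs_dotProduct_le {p v : ι → ℝ} {B : ℝ} (hp : ∀ i, |p i| ≤ B) :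
    |p ⬝ᵥ v| ≤ B * ∑ i, |v i| := by
  rw [Finset.mul_sum]
  refine (Finset.abs_sum_le_sum_abs _ _).trans (Finset.sum_le_sum fun i _ => ?_)
  rw [abs_mul]
  exact mul_le_mul_of_nonneg_right (hp i) (abs_nonneg _)

lemma sum_abs_eq_one {u : ι → ℝ} (hu : u ∈ stdSimplex ℝ ι) : ∑ i, |u i| = 1 := by
  simp_rw [abs_of_nonneg (hu.1 _), hu.2]

lemma sum_abs_sub_le_two {u v : ι → ℝ} (hu : u ∈ stdSimplex ℝ ι) (hv : v ∈ stdSimplex ℝ ι) :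
    ∑ i, |u i - v i| ≤ 2 := by
  calc ∑ i, |u i - v i| ≤ ∑ i, (u i + v i) := Finset.sum_le_sum fun i _ =>
        abs_le.2 ⟨by linarith [hu.1 i, hv.1 i], by linarith [hu.1 i, hv.1 i]⟩
    _ = 2 := by rw [Finset.sum_add_distrib, hu.2, hv.2]; norm_num

variable [Nonempty ι]

/-- The entropically regularized symmetric game with payoff `N` and linear cost `b` has an
equilibrium.  As `N` is skew, `F(z) = KL(z ‖ gibbs c (N z + b))` is the duality gap of `z` and is
convex; at a minimizer `z`, the derivative of `F` towards the best response
`gibbs c (N z + b)` is `-F(z)`, hence `F(z) = 0`. -/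
lemma exists_gibbs_fixedPoint {c : ι → ℝ} (hc0 : ∀ i, 0 < c i)
    {N : Matrix ι ι ℝ} (hN : Nᵀ = -N) (b : ι → ℝ) :
    ∃ z ∈ stdSimplex ℝ ι, z = gibbs c (N *ᵥ z + b) := by
  classical
  set F : (ι → ℝ) → ℝ := fun z =>
    relEntropy z c + b ⬝ᵥ z + Real.log (∑ j, c j * Real.exp (-(N *ᵥ z + b) j)) with hF
  have hcont : Continuous F := by
    refine ((continuous_relEntropy hc0).add (by fun_prop)).add ?_
    refine Continuous.log ?_ fun z => (gibbs_sum_pos hc0 _).ne'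
    have : Continuous fun z : ι → ℝ => N *ᵥ z := by fun_prop
    fun_prop
  obtain ⟨z, hz, hmin⟩ := (isCompact_stdSimplex ℝ ι).exists_isMinOn
    ⟨_, single_mem_stdSimplex ℝ (Classical.arbitrary ι)⟩ hcont.continuousOn
  refine ⟨z, hz, ?_⟩
  set û := gibbs c (N *ᵥ z + b) with hû
  have hu : û ∈ stdSimplex ℝ ι := gibbs_mem hc0 _
  have hu0 : ∀ i, 0 < û i := gibbs_pos hc0 _
  refine eq_of_relEntropy_le_zero hz hu hu0 ?_
  by_contra! hκ
  set κ := relEntropy z û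
  set w := N *ᵥ (û - z) with hw
  set C := ∑ j, û j * w j ^ 2
  have hC : 0 ≤ C := Finset.sum_nonneg fun j _ => mul_nonneg (hu0 j).le (sq_nonneg _)
  set B := ∑ j, |w j|
  have hB : 0 ≤ B := Finset.sum_nonneg fun j _ => abs_nonneg _
  set s := min (1 / (1 + B)) (κ / (2 * (C + 1))) with hs
  have hs0 : 0 < s := lt_min (by positivity) (by positivity)
  have hsB : s * (1 + B) ≤ 1 := by
    rw [← le_div_iff₀ (by positivity)]; exact min_le_left _ _
  have hsC : s * (2 * (C + 1)) ≤ κ := by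
    rw [← le_div_iff₀ (by positivity)]; exact min_le_right _ _
  have hs1 : s ≤ 1 := by nlinarith [mul_nonneg hs0.le hB]
  have hzs : z + s • (û - z) ∈ stdSimplex ℝ ι :=
    (convex_stdSimplex ℝ ι).add_smul_sub_mem hz hu ⟨hs0.le, hs1⟩
  have h1 : F z ≤ F (z + s • (û - z)) := hmin hzs
  have h2 := relEntropy_segment_le hc0 hz.1 hu.1 hs0.le hs1
  have hsplit : N *ᵥ (z + s • (û - z)) + b = (N *ᵥ z + b) + s • w := by
    rw [Matrix.mulVec_add, Matrix.mulVec_smul, ← hw]; abel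
  have h3 : Real.log (∑ j, û j * Real.exp (-(s • w) j)) ≤ -((s • w) ⬝ᵥ û) +
      ∑ j, û j * (s • w) j ^ 2 := by
    refine log_sum_mul_exp_neg_le hu hu0 fun i => ?_
    rw [Pi.smul_apply, smul_eq_mul, abs_mul, abs_of_pos hs0]
    have : |w i| ≤ B := Finset.single_le_sum (f := fun j => |w j|) (fun j _ => abs_nonneg _)
      (Finset.mem_univ i)
    nlinarith
  have h4 : ∑ j, û j * (s • w) j ^ 2 = s ^ 2 * C := by
    rw [Finset.mul_sum]
    exact Finset.sum_congr rfl fun j _ => by rw [Pi.smul_apply, smul_eq_mul]; ring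
  have h5 := dotProduct_gibbs_sub hc0 (N *ᵥ z + b) hz
  rw [← hû, add_dotProduct, dotProduct_sub (N *ᵥ z), skew_dotProduct_self hN] at h5
  have h6 : w ⬝ᵥ û = -((N *ᵥ z) ⬝ᵥ û) := by
    rw [hw, Matrix.mulVec_sub, sub_dotProduct, skew_dotProduct_self hN]; ring
  simp only [hF] at h1
  rw [hsplit, log_sum_mul_exp_neg_add hc0 (N *ᵥ z + b) (s • w), ← hû, dotProduct_add, dotProduct_smul,
    smul_eq_mul] at h1
  rw [smul_dotProduct, smul_eq_mul, h6, h4] at h3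
  have h7 : 0 ≤ s * -κ + s * (s * C) := by
    have : s * (b ⬝ᵥ (û - z) + (N *ᵥ z) ⬝ᵥ û) = s * (relEntropy z c - κ - relEntropy û c) := by
      rw [← h5]; ring
    linarith
  nlinarith

/-- A proximal step around `c` for the model `g + N (z - c)` of the payoff vector, with
regularization `lam ≥ α` just large enough for the step to have length (in relative entropy) at
most `r`: the length is exactly `r` unless `lam = α`.  It exists because the length of the step
depends continuously on `lam` and tends to `0`. -/
lemma exists_proximal_step {c : ι → ℝ} (hc : c ∈ stdSimplex ℝ ι) (hc0 : ∀ i, 0 < c i)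
    {N : Matrix ι ι ℝ} (hN : Nᵀ = -N) (g : ι → ℝ) {α r : ℝ} (hα : 0 < α) (hr : 0 < r) :
    ∃ (lam : ℝ) (z : ι → ℝ), α ≤ lam ∧ z = gibbs c (lam⁻¹ • (g + N *ᵥ (z - c))) ∧
      relEntropy z c ≤ r ∧ (lam = α ∨ relEntropy z c = r) := by
  have hex (lam : ℝ) : ∃ z, z = gibbs c (lam⁻¹ • (g + N *ᵥ (z - c))) := by
    obtain ⟨z, -, hz⟩ := exists_gibbs_fixedPoint hc0 (N := lam⁻¹ • N)
      (by rw [Matrix.transpose_smul, hN, smul_neg]) (lam⁻¹ • (g - N *ᵥ c))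
    refine ⟨z, hz.trans ?_⟩
    congr 1
    rw [Matrix.smul_mulVec, ← smul_add, Matrix.mulVec_sub]
    congr 1; abel
  choose z hz using hex
  have hmem (lam : ℝ) : z lam ∈ stdSimplex ℝ ι := by rw [hz]; exact gibbs_mem hc0 _
  have hpos (lam : ℝ) : ∀ i, 0 < z lam i := by rw [hz]; exact gibbs_pos hc0 _
  set G : ℝ → ι → ℝ := fun lam => g + N *ᵥ (z lam - c) with hG
  set φ : ℝ → ℝ := fun lam => relEntropy (z lam) c with hφ
  have hφ0 (lam : ℝ) : 0 ≤ φ lam := relEntropy_nonneg (hmem _) hc hc0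
  have three {lam : ℝ} (hl : 0 < lam) {u : ι → ℝ} (hu : u ∈ stdSimplex ℝ ι) :
      G lam ⬝ᵥ (z lam - u) = lam * (relEntropy u c - relEntropy u (z lam) - φ lam) := by
    have h := dotProduct_gibbs_sub hc0 (lam⁻¹ • G lam) hu
    rw [← hz lam, smul_dotProduct, smul_eq_mul] at h
    rw [← h, mul_inv_cancel_left₀ hl.ne']
  have key {lam mu : ℝ} (hl : 0 < lam) (hm : 0 < mu) :
      lam * relEntropy (z mu) (z lam) + mu * relEntropy (z lam) (z mu) =
        (lam - mu) * (φ mu - φ lam) := by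
    have h1 := three hl (hmem mu)
    have h2 := three hm (hmem lam)
    have h3 : G lam ⬝ᵥ (z lam - z mu) + G mu ⬝ᵥ (z mu - z lam) = 0 := by
      rw [← neg_sub (z lam) (z mu), dotProduct_neg, ← sub_eq_add_neg, ← sub_dotProduct]
      have : G lam - G mu = N *ᵥ (z lam - z mu) := by
        simp only [hG, Matrix.mulVec_sub]; abel
      rw [this, skew_dotProduct_self hN]
    linarith
  obtain ⟨B, hB⟩ : ∃ B, ∀ lam i, |G lam i| ≤ B := by
    obtain ⟨B, hB⟩ := (isCompact_stdSimplex ℝ ι).exists_bound_of_continuousOn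
      (f := fun z => g + N *ᵥ (z - c)) (by fun_prop)
    exact ⟨B, fun lam i => (norm_le_pi_norm (G lam) i).trans (hB _ (hmem lam))⟩
  have hB0 : 0 ≤ B := (abs_nonneg _).trans (hB 0 (Classical.arbitrary ι))
  have hφB {lam : ℝ} (hl : 0 < lam) : φ lam ≤ 2 * B / lam := by
    have h1 := three hl hc
    have h2 := (abs_dotProduct_le (v := z lam - c) (hB lam)).trans
      (mul_le_mul_of_nonneg_left (sum_abs_sub_le_two (hmem lam) hc) hB0)
    rw [relEntropy_self hc0] at h1
    have h3 := mul_nonneg hl.le (relEntropy_nonneg hc (hmem lam) (hpos lam))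
    rw [le_div_iff₀ hl]
    linarith [(abs_le.1 h2).1]
  have hmod {lam mu : ℝ} (hl : α ≤ lam) (hm : α ≤ mu) :
      |φ mu - φ lam| ≤ |lam - mu| * (2 * B / α / α) +
        B / α * √(4 * (|lam - mu| * (2 * B / α / α))) := by
    have hl0 := hα.trans_le hl
    have hm0 := hα.trans_le hm
    have hk := key hl0 hm0
    have hbd {t : ℝ} (ht : α ≤ t) : φ t ≤ 2 * B / α := (hφB (hα.trans_le ht)).trans (by gcongr)
    have hφd : |φ mu - φ lam| ≤ 2 * B / α :=
      abs_le.2 ⟨by linarith [hbd hl, hφ0 mu], by linarith [hbd hm, hφ0 lam]⟩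
    have hkl : relEntropy (z mu) (z lam) ≤ |lam - mu| * (2 * B / α / α) := by
      have h1 : lam * relEntropy (z mu) (z lam) ≤ |lam - mu| * (2 * B / α) := by
        have := mul_nonneg hm0.le (relEntropy_nonneg (hmem lam) (hmem mu) (hpos mu))
        have h2 := le_abs_self ((lam - mu) * (φ mu - φ lam))
        rw [abs_mul] at h2
        have := mul_le_mul_of_nonneg_left hφd (abs_nonneg (lam - mu))
        linarith
      rw [← mul_div_assoc, le_div_iff₀ hα, mul_comm]
      exact (mul_le_mul_of_nonneg_right hl
        (relEntropy_nonneg (hmem mu) (hmem lam) (hpos lam))).trans h1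
    have h1 := three hl0 (hmem mu)
    have h2 : ∑ i, |z lam i - z mu i| ≤ √(4 * (|lam - mu| * (2 * B / α / α))) := by
      refine Real.le_sqrt_of_sq_le ?_
      have := sum_abs_sub_sq_le (hmem mu) (hmem lam) (hpos lam)
      simp_rw [abs_sub_comm (z lam _)]
      linarith
    have h3 : |φ mu - φ lam - relEntropy (z mu) (z lam)| ≤
        B / α * √(4 * (|lam - mu| * (2 * B / α / α))) := by
      have h4 : |G lam ⬝ᵥ (z lam - z mu)| ≤ B * √(4 * (|lam - mu| * (2 * B / α / α))) :=
        (abs_dotProduct_le (v := z lam - z mu) (hB lam)).trans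
          (mul_le_mul_of_nonneg_left h2 hB0)
      rw [h1, abs_mul, abs_of_pos hl0] at h4
      rw [div_mul_eq_mul_div, le_div_iff₀ hα, mul_comm]
      refine le_trans ?_ h4
      rw [show φ mu - φ lam - relEntropy (z mu) (z lam) =
        relEntropy (z mu) c - relEntropy (z mu) (z lam) - φ lam by simp only [hφ]; ring]
      exact mul_le_mul_of_nonneg_right hl (abs_nonneg _)
    have h5 := relEntropy_nonneg (hmem mu) (hmem lam) (hpos lam)
    rw [abs_le] at h3 ⊢
    constructor <;> linarith [h3.1, h3.2]
  have hcont : ContinuousOn φ (Set.Ici α) := by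
    intro lam hl
    rw [ContinuousWithinAt, tendsto_iff_norm_sub_tendsto_zero]
    refine squeeze_zero' (Filter.Eventually.of_forall fun _ => norm_nonneg _)
      (Filter.eventually_of_mem self_mem_nhdsWithin fun mu hm => hmod hl hm) ?_
    refine Filter.Tendsto.mono_left ?_ nhdsWithin_le_nhds
    refine Continuous.tendsto' (by fun_prop) _ _ (by simp)
  by_cases h : φ α ≤ r
  · exact ⟨α, z α, le_rfl, hz α, h, Or.inl rfl⟩
  · push Not at h
    set L := max α (2 * B / r)
    have hL : φ L ≤ r := by
      have hL0 : 0 < L := hα.trans_le (le_max_left _ _)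
      refine (hφB hL0).trans ?_
      rw [div_le_iff₀ hL0, mul_comm r, ← div_le_iff₀ hr]
      exact le_max_right _ _
    obtain ⟨lam, hlam, he⟩ := intermediate_value_Icc' (le_max_left α (2 * B / r))
      (hcont.mono Set.Icc_subset_Ici_self) ⟨hL, h.le⟩
    exact ⟨lam, z lam, hlam.1, hz lam, he.le, Or.inr he⟩

end Proximal

/-! ### Local norms and model correction -/

section Local

variable {ι : Type*} [Fintype ι]

/-- The squared Frobenius norm of `D` in the local norm given by the weights `w`. -/
noncomputable def weightedSq (w : ι → ℝ) (D : Matrix ι ι ℝ) : ℝ :=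
  ∑ i, ∑ j, w i * w j * D i j ^ 2

lemma weightedSq_le_four {w : ι → ℝ} (hw : w ∈ stdSimplex ℝ ι) {D : Matrix ι ι ℝ}
    (hD : ∀ i j, |D i j| ≤ 2) : weightedSq w D ≤ 4 := by
  calc weightedSq w D ≤ ∑ i, ∑ j, w i * w j * 4 := by
        refine Finset.sum_le_sum fun i _ => Finset.sum_le_sum fun j _ => ?_
        refine mul_le_mul_of_nonneg_left ?_ (mul_nonneg (hw.1 i) (hw.1 j))
        have := sq_le_sq' (abs_le.1 (hD i j)).1 (abs_le.1 (hD i j)).2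
        linarith
    _ = 4 := by
        simp_rw [← Finset.sum_mul, ← Finset.mul_sum, hw.2, mul_one, hw.2, one_mul]

lemma weightedSq_nonneg {w : ι → ℝ} (hw : w ∈ stdSimplex ℝ ι) (D : Matrix ι ι ℝ) :
    0 ≤ weightedSq w D :=
  Finset.sum_nonneg fun i _ => Finset.sum_nonneg fun j _ =>
    mul_nonneg (mul_nonneg (hw.1 i) (hw.1 j)) (sq_nonneg _)

/-- The local norm is stable under small moves of the weights. -/
lemma weightedSq_le_add {w z : ι → ℝ} (hw : w ∈ stdSimplex ℝ ι) (hz : z ∈ stdSimplex ℝ ι)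
    {D : Matrix ι ι ℝ} (hD : ∀ i j, |D i j| ≤ 2) :
    weightedSq w D ≤ weightedSq z D + 8 * ∑ i, |w i - z i| := by
  have hsum : ∑ i, ∑ j, 4 * (|w i - z i| * w j + z i * |w j - z j|) = 8 * ∑ i, |w i - z i| := by
    simp_rw [← Finset.mul_sum, Finset.sum_add_distrib, ← Finset.mul_sum, ← Finset.sum_mul, hw.2,
      hz.2]
    ring
  rw [← hsum, weightedSq, weightedSq, ← Finset.sum_add_distrib]
  refine Finset.sum_le_sum fun i _ => ?_
  rw [← Finset.sum_add_distrib]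
  refine Finset.sum_le_sum fun j _ => ?_
  have hD2 : D i j ^ 2 ≤ 4 := by
    have := sq_le_sq' (abs_le.1 (hD i j)).1 (abs_le.1 (hD i j)).2
    linarith
  have h1 : (w i - z i) * w j ≤ |w i - z i| * w j :=
    mul_le_mul_of_nonneg_right (le_abs_self _) (hw.1 j)
  have h2 : z i * (w j - z j) ≤ z i * |w j - z j| :=
    mul_le_mul_of_nonneg_left (le_abs_self _) (hz.1 i)
  have h3 : 0 ≤ |w i - z i| * w j + z i * |w j - z j| :=
    add_nonneg (mul_nonneg (abs_nonneg _) (hw.1 j)) (mul_nonneg (hz.1 i) (abs_nonneg _))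
  nlinarith [sq_nonneg (D i j), mul_le_mul_of_nonneg_right hD2 h3]

/-- The model `N` of a skew matrix, updated to be exact in the direction `a`, where the true
matrix exceeds it by `h`: a row-wise orthogonal projection in the local norm given by `w`,
followed by the projections onto skew matrices and onto matrices with entries in `[-1, 1]`. -/
noncomputable def correctModel (N : Matrix ι ι ℝ) (h a w : ι → ℝ) : Matrix ι ι ℝ :=
  let M : Matrix ι ι ℝ := Matrix.of fun i j => N i j + h i / (∑ k, a k ^ 2 / w k) * (a j / w j)
  Matrix.of fun i j => max (-1) (min 1 ((M i j - M j i) / 2))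

lemma correctModel_transpose (N : Matrix ι ι ℝ) (h a w : ι → ℝ) :
    (correctModel N h a w)ᵀ = -correctModel N h a w := by
  ext i j
  simp only [Matrix.transpose_apply, Matrix.neg_apply, correctModel, Matrix.of_apply]
  grind

lemma abs_correctModel_le (N : Matrix ι ι ℝ) (h a w : ι → ℝ) (i j : ι) :
    |correctModel N h a w i j| ≤ 1 := by
  simp only [correctModel, Matrix.of_apply]
  exact abs_le.2 ⟨le_max_left _ _, max_le (by norm_num) (min_le_left _ _)⟩

/-- Correcting the model in a direction `a` reduces its error by the weighted squared length of
the error `h` in that direction. -/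
lemma weightedSq_correctModel_le {S N : Matrix ι ι ℝ} (hS : Sᵀ = -S) (hS1 : ∀ i j, |S i j| ≤ 1)
    {h a w : ι → ℝ} (hw : ∀ i, 0 < w i) (hh : h = (S - N) *ᵥ a) :
    weightedSq w (S - correctModel N h a w) ≤
      weightedSq w (S - N) - (∑ i, w i * h i ^ 2) / ∑ k, a k ^ 2 / w k := by
  set q := ∑ k, a k ^ 2 / w k with hq
  set M : Matrix ι ι ℝ := Matrix.of fun i j => N i j + h i / q * (a j / w j) with hM
  have hsk (i j : ι) : S j i = -S i j := by simpa using congrFun (congrFun hS i) j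
  -- Clipping and taking skew parts do not increase the distance to `S`.
  have h1 : weightedSq w (S - correctModel N h a w) ≤ weightedSq w (S - M) := by
    have hpt (i j : ι) : (S i j - correctModel N h a w i j) ^ 2 ≤
        ((S i j - M i j) ^ 2 + (S j i - M j i) ^ 2) / 2 := by
      have hc : correctModel N h a w i j = max (-1) (min 1 ((M i j - M j i) / 2)) := rfl
      have hS' := abs_le.1 (hS1 i j)
      have : (S i j - correctModel N h a w i j) ^ 2 ≤ (S i j - (M i j - M j i) / 2) ^ 2 := by
        rw [hc]
        rcases le_total ((M i j - M j i) / 2) (-1) with hx | hx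
        · rw [max_eq_left ((min_le_right _ _).trans hx)]; nlinarith
        rcases le_total ((M i j - M j i) / 2) 1 with hy | hy
        · rw [min_eq_right hy, max_eq_right hx]
        · rw [min_eq_left hy, max_eq_right (by norm_num)]; nlinarith
      rw [hsk i j]
      nlinarith [sq_nonneg (S i j - M i j + (-S i j - M j i))]
    have hswap : ∑ i, ∑ j, w i * w j * (S j i - M j i) ^ 2 =
        ∑ i, ∑ j, w i * w j * (S i j - M i j) ^ 2 := by
      rw [Finset.sum_comm]
      exact Finset.sum_congr rfl fun i _ => Finset.sum_congr rfl fun j _ => by ring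
    calc _ ≤ ∑ i, ∑ j, (w i * w j * (S i j - M i j) ^ 2 + w i * w j * (S j i - M j i) ^ 2) / 2 :=
          Finset.sum_le_sum fun i _ => Finset.sum_le_sum fun j _ => by
            have := mul_le_mul_of_nonneg_left (hpt i j) (mul_pos (hw i) (hw j)).le
            simp only [Matrix.sub_apply]
            linarith
      _ = weightedSq w (S - M) := by
          simp_rw [← Finset.sum_div, Finset.sum_add_distrib, hswap, weightedSq, Matrix.sub_apply]
          ring
  refine h1.trans_eq ?_
  have hrow (i : ι) : ∑ j, w i * w j * (S - M) i j ^ 2 =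
      ∑ j, w i * w j * (S - N) i j ^ 2 - w i * h i ^ 2 / q := by
    have hterm (j : ι) : w i * w j * (S - M) i j ^ 2 = w i * w j * (S - N) i j ^ 2 -
        2 * (w i * h i / q) * ((S - N) i j * a j) + w i * (h i / q) ^ 2 * (a j ^ 2 / w j) := by
      have := (hw j).ne'
      simp only [Matrix.sub_apply, hM, Matrix.of_apply]
      field_simp
      ring
    have hi : ∑ j, (S - N) i j * a j = h i := by rw [hh]; rfl
    simp_rw [hterm, Finset.sum_add_distrib, Finset.sum_sub_distrib, ← Finset.mul_sum, hi, ← hq]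
    rcases eq_or_ne q 0 with h0 | h0
    · simp [h0]
    · field_simp; ring
  rw [weightedSq, Finset.sum_congr rfl fun i _ => hrow i, Finset.sum_sub_distrib,
    ← Finset.sum_div, weightedSq]

end Local

/-! ### The method for symmetric games -/

section Method

variable {ι : Type*} [Fintype ι]

/-- The state of the method: the current proximal center, the current model of the payoff matrix,
the weighted sum of the points accepted so far, and the sum of their weights. -/
structure State (ι : Type*) where
  center : ι → ℝ
  model : Matrix ι ι ℝ
  sum : ι → ℝ
  weight : ℝ

/-- `(lam, z)` is a proximal step around `c` for the model `g + N (z - c)` of the payoff vector,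
with regularization `lam ≥ α` adapted so that the step has length at most `r ^ 2`. -/
def IsProxStep (α r : ℝ) (c : ι → ℝ) (N : Matrix ι ι ℝ) (g : ι → ℝ) (p : ℝ × (ι → ℝ)) : Prop :=
  α ≤ p.1 ∧ p.2 = gibbs c (p.1⁻¹ • (g + N *ᵥ (p.2 - c))) ∧
    relEntropy p.2 c ≤ r ^ 2 ∧ (p.1 = α ∨ relEntropy p.2 c = r ^ 2)

open Classical in
/-- A choice of a proximal step, with a dummy value where none exists. -/
noncomputable def proxStep (α r : ℝ) (c : ι → ℝ) (N : Matrix ι ι ℝ) (g : ι → ℝ) :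
    ℝ × (ι → ℝ) :=
  if h : ∃ p, IsProxStep α r c N g p then h.choose else (α, c)

open Classical in
/-- The update of the state `s`, given the payoffs `g` of its center and `g'` of the proximal
point.  If the model predicted `g'` well, the proximal point is accepted and the center moves to
the corresponding mirror step; otherwise the center stays and the model is corrected. -/
noncomputable def State.next (α r : ℝ) (s : State ι) (g g' : ι → ℝ) : State ι :=
  let p := proxStep α r s.center s.model g
  let h := g' - g - s.model *ᵥ (p.2 - s.center)
  if ∑ i, p.2 i * h i ^ 2 ≤ p.1 ^ 2 * relEntropy p.2 s.center / 2 then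
    ⟨gibbs p.2 (p.1⁻¹ • h), s.model, s.sum + p.1⁻¹ • p.2, s.weight + p.1⁻¹⟩
  else
    ⟨s.center, correctModel s.model h (p.2 - s.center) ((1 / 2 : ℝ) • (p.2 + s.center)),
      s.sum, s.weight⟩

/-- The initial state: uniform center and zero model. -/
noncomputable def State.init (ι : Type*) [Fintype ι] : State ι :=
  ⟨fun _ => (Fintype.card ι : ℝ)⁻¹, 0, 0, 0⟩

/-- The accuracy of the model, and the progress of the method on the game with payoff `S`, after
`k` iterations.  `Q` is the total length of the accepted proximal steps.  The field `count`
charges the iterations: a correction lowers `32 / α ^ 2 * weightedSq` by at least `1`, while an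
accepted step raises it by at most `2` and raises `α * weight + Q / r ^ 2` by at least `1`, as its
regularization is `α` or its length is `r ^ 2`. -/
structure Invariant (S : Matrix ι ι ℝ) (α r : ℝ) (k : ℕ) (Q : ℝ) (s : State ι) : Prop where
  center_mem : s.center ∈ stdSimplex ℝ ι
  center_pos : ∀ i, 0 < s.center i
  model_skew : s.modelᵀ = -s.model
  abs_model_le : ∀ i j, |s.model i j| ≤ 1
  weight_nonneg : 0 ≤ s.weight
  length_nonneg : 0 ≤ Q
  exists_mean : ∃ p ∈ stdSimplex ℝ ι, s.sum = s.weight • p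
  regret : ∀ u ∈ stdSimplex ℝ ι, -((S *ᵥ s.sum) ⬝ᵥ u) + relEntropy u s.center + Q / 2 ≤
    Real.log (Fintype.card ι)
  count : k + 32 / α ^ 2 * weightedSq s.center (S - s.model) ≤
    3 * α * s.weight + 3 * (Q / r ^ 2) + 32 / α ^ 2 * 4

/-- Once enough iterations have been made, the weighted mean of the accepted points is a
near-optimal strategy of the symmetric game. -/
lemma Invariant.mean_spec {S : Matrix ι ι ℝ} (hS : Sᵀ = -S) {α r ε : ℝ} (hα : 0 < α)
    (hε : 0 < ε) {k : ℕ} {Q : ℝ} {s : State ι} (hs : Invariant S α r k Q s)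
    (hk : 3 * α / ε * Real.log (Fintype.card ι) + 6 / r ^ 2 * Real.log (Fintype.card ι) +
      128 / α ^ 2 < k) :
    s.weight⁻¹ • s.sum ∈ stdSimplex ℝ ι ∧
      ∀ u ∈ stdSimplex ℝ ι, -((S *ᵥ (s.weight⁻¹ • s.sum)) ⬝ᵥ u) ≤ ε := by
  obtain ⟨m, hm, hsum⟩ := hs.exists_mean
  set L := Real.log (Fintype.card ι)
  have hQ : Q ≤ 2 * L := by
    have h1 := hs.regret m hm
    have h2 : (S *ᵥ s.sum) ⬝ᵥ m = 0 := by
      rw [hsum, Matrix.mulVec_smul, smul_dotProduct, skew_dotProduct_self hS, smul_zero]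
    linarith [relEntropy_nonneg hm hs.center_mem hs.center_pos]
  have hL : 0 ≤ L := Real.log_natCast_nonneg _
  have hΛ : 3 * α / ε * L < 3 * α * s.weight := by
    have h1 := hs.count
    have h2 := mul_nonneg (show 0 ≤ 32 / α ^ 2 by positivity)
      (weightedSq_nonneg hs.center_mem (S - s.model))
    have h3 : Q / r ^ 2 ≤ 2 * L / r ^ 2 := by gcongr
    have h4 : 6 / r ^ 2 * L = 3 * (2 * L / r ^ 2) := by ring
    have h5 : 128 / α ^ 2 = 32 / α ^ 2 * 4 := by ring
    linarith
  have hΛ' : L / ε < s.weight := by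
    refine lt_of_mul_lt_mul_left ?_ (show 0 ≤ 3 * α by positivity)
    calc 3 * α * (L / ε) = 3 * α / ε * L := by ring
      _ < _ := hΛ
  have hΛ0 : 0 < s.weight := (div_nonneg hL hε.le).trans_lt hΛ'
  constructor
  · rw [hsum, inv_smul_smul₀ hΛ0.ne']; exact hm
  · intro u hu
    have h1 := hs.regret u hu
    have h2 := relEntropy_nonneg hu hs.center_mem hs.center_pos
    have hQ0 : 0 ≤ Q := hs.length_nonneg
    rw [Matrix.mulVec_smul, smul_dotProduct, smul_eq_mul, ← mul_neg, inv_mul_le_iff₀ hΛ0]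
    rw [div_lt_iff₀ hε] at hΛ'
    linarith

variable [Nonempty ι]

lemma uniform_mem : (fun _ => (Fintype.card ι : ℝ)⁻¹) ∈ stdSimplex ℝ ι := by
  refine ⟨fun _ => by positivity, ?_⟩
  rw [Finset.sum_const, Finset.card_univ, nsmul_eq_mul, mul_inv_cancel₀]
  exact_mod_cast Fintype.card_ne_zero

lemma Invariant.init {S : Matrix ι ι ℝ} (hS1 : ∀ i j, |S i j| ≤ 1) (α r : ℝ) :
    Invariant S α r 0 0 (State.init ι) where
  center_mem := uniform_mem
  center_pos _ := by simp only [State.init]; positivity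
  model_skew := by simp [State.init]
  abs_model_le := by simp [State.init]
  weight_nonneg := le_rfl
  length_nonneg := le_rfl
  exists_mean := ⟨_, uniform_mem, by simp [State.init]⟩
  regret u hu := by simpa [State.init] using relEntropy_uniform_le hu
  count := by
    have : weightedSq (State.init ι).center (S - (State.init ι).model) ≤ 4 :=
      weightedSq_le_four uniform_mem fun i j => by
        simpa [State.init] using (hS1 i j).trans one_le_two
    have := mul_le_mul_of_nonneg_left this (show 0 ≤ 32 / α ^ 2 by positivity)
    simpa [State.init] using this

lemma proxStep_spec {α r : ℝ} (hα : 0 < α) (hr : 0 < r) {c : ι → ℝ} (hc : c ∈ stdSimplex ℝ ι)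
    (hc0 : ∀ i, 0 < c i) {N : Matrix ι ι ℝ} (hN : Nᵀ = -N) (g : ι → ℝ) :
    IsProxStep α r c N g (proxStep α r c N g) := by
  have h : ∃ p, IsProxStep α r c N g p := by
    obtain ⟨lam, z, h⟩ := exists_proximal_step hc hc0 hN g hα (sq_pos_of_pos hr)
    exact ⟨(lam, z), h⟩
  rw [proxStep, dif_pos h]
  exact h.choose_spec

lemma Invariant.next {S : Matrix ι ι ℝ} (hS : Sᵀ = -S) (hS1 : ∀ i j, |S i j| ≤ 1)
    {α r : ℝ} (hα : 0 < α) (hα1 : α ≤ 1) (hr : r = α ^ 2 / 512) {k : ℕ} {Q : ℝ} {s : State ι}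
    (hs : Invariant S α r k Q s) :
    ∃ Q', Invariant S α r (k + 1) Q'
      (s.next α r (S *ᵥ s.center) (S *ᵥ (proxStep α r s.center s.model (S *ᵥ s.center)).2)) := by
  have hr0 : 0 < r := by rw [hr]; positivity
  obtain ⟨c, N, σ, Λ⟩ := s
  obtain ⟨hc, hc0, hN, hN1, hΛ, hQ, ⟨m, hm, hσ⟩, hreg, hcount⟩ := hs
  dsimp only at *
  obtain ⟨hlam, hz, hrho, hor⟩ := proxStep_spec hα hr0 hc hc0 hN (S *ᵥ c)
  set lam := (proxStep α r c N (S *ᵥ c)).1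
  set z := (proxStep α r c N (S *ᵥ c)).2
  have hlam0 : 0 < lam := hα.trans_le hlam
  have hzm : z ∈ stdSimplex ℝ ι := by rw [hz]; exact gibbs_mem hc0 _
  have hz0 : ∀ i, 0 < z i := by rw [hz]; exact gibbs_pos hc0 _
  set h := S *ᵥ z - S *ᵥ c - N *ᵥ (z - c) with hh
  have hh' : h = (S - N) *ᵥ (z - c) := by
    rw [hh, Matrix.sub_mulVec, Matrix.mulVec_sub S]
  have hD {M : Matrix ι ι ℝ} (hM : ∀ i j, |M i j| ≤ 1) (i j : ι) : |(S - M) i j| ≤ 2 := by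
    rw [Matrix.sub_apply]
    exact (abs_sub _ _).trans (by linarith [hS1 i j, hM i j])
  have hzc : ∑ i, |z i - c i| ≤ 2 * r := sum_abs_sub_le hzm hc hc0 hr0.le hrho
  have hrho0 : 0 ≤ relEntropy z c := relEntropy_nonneg hzm hc hc0
  simp only [State.next]
  change ∃ Q', Invariant S α r (k + 1) Q' (if ∑ i, z i * h i ^ 2 ≤ lam ^ 2 * relEntropy z c / 2
    then _ else _)
  split_ifs with hpass
  · set z' := gibbs z (lam⁻¹ • h) with hz'
    have hz'm : z' ∈ stdSimplex ℝ ι := gibbs_mem hz0 _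
    have hz'0 : ∀ i, 0 < z' i := gibbs_pos hz0 _
    have hh1 (i : ι) : |(lam⁻¹ • h) i| ≤ 1 := by
      have h1 : |h i| ≤ 2 * ∑ j, |(z - c) j| := by
        rw [hh']; exact abs_dotProduct_le (hD hN1 i)
      rw [Pi.smul_apply, smul_eq_mul, abs_mul, abs_inv, abs_of_pos hlam0, inv_mul_le_iff₀ hlam0]
      refine h1.trans ?_
      simp only [Pi.sub_apply]
      nlinarith
    have hmove : relEntropy z z' ≤ relEntropy z c / 2 := by
      refine (relEntropy_gibbs_self_le hzm hz0 hh1).trans ?_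
      have : ∑ j, z j * (lam⁻¹ • h) j ^ 2 = (∑ j, z j * h j ^ 2) / lam ^ 2 := by
        rw [Finset.sum_div]
        exact Finset.sum_congr rfl fun j _ => by
          rw [Pi.smul_apply, smul_eq_mul]; field_simp
      rw [this, div_le_iff₀ (by positivity)]
      linarith
    -- The mirror step can be taken from `c` as well, with the true payoff of `z`.
    have hz'c : z' = gibbs c (lam⁻¹ • S *ᵥ z) := by
      have : gibbs z (lam⁻¹ • h) = gibbs (gibbs c (lam⁻¹ • (S *ᵥ c + N *ᵥ (z - c)))) (lam⁻¹ • h) :=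
        congrArg (fun y => gibbs y (lam⁻¹ • h)) hz
      rw [hz', this, gibbs_gibbs hc0, ← smul_add, hh]
      congr 2; abel
    have hstep {u : ι → ℝ} (hu : u ∈ stdSimplex ℝ ι) : -(lam⁻¹ * ((S *ᵥ z) ⬝ᵥ u)) =
        relEntropy u c - relEntropy u z' - relEntropy z c + relEntropy z z' := by
      have h1 := dotProduct_gibbs_sub hc0 (lam⁻¹ • S *ᵥ z) hu
      have h2 := dotProduct_gibbs_sub hc0 (lam⁻¹ • S *ᵥ z) hzm
      rw [← hz'c, dotProduct_sub, smul_dotProduct, smul_dotProduct, smul_eq_mul, smul_eq_mul]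
        at h1 h2
      rw [skew_dotProduct_self hS] at h2
      linarith
    have hzz' : ∑ i, |z i - z' i| ≤ 2 * r :=
      sum_abs_sub_le hzm hz'm hz'0 hr0.le (by linarith)
    have hcz' : ∑ i, |z' i - c i| ≤ 4 * r := by
      calc ∑ i, |z' i - c i| ≤ ∑ i, (|z i - c i| + |z i - z' i|) :=
            Finset.sum_le_sum fun i _ => by
              rw [add_comm, abs_sub_comm (z i)]; exact abs_sub_le _ _ _
        _ ≤ 4 * r := by rw [Finset.sum_add_distrib]; linarith
    refine ⟨Q + relEntropy z c, hz'm, hz'0, hN, hN1, by positivity, by positivity, ?_, fun u hu => ?_, ?_⟩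
    · have hΛ' : 0 < Λ + lam⁻¹ := by positivity
      refine ⟨(Λ / (Λ + lam⁻¹)) • m + (lam⁻¹ / (Λ + lam⁻¹)) • z,
        convex_stdSimplex ℝ ι hm hzm (by positivity) (by positivity) (by field_simp), ?_⟩
      rw [hσ, smul_add, smul_smul, smul_smul, mul_div_cancel₀ _ hΛ'.ne', mul_div_cancel₀ _ hΛ'.ne']
    · have h1 := hreg u hu
      have h2 := hstep hu
      dsimp only
      rw [Matrix.mulVec_add, Matrix.mulVec_smul, add_dotProduct, smul_dotProduct, smul_eq_mul]
      linarith
    · have h1 := weightedSq_le_add hz'm hc (hD hN1)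
      have h2 : 32 / α ^ 2 * weightedSq z' (S - N) ≤ 32 / α ^ 2 * weightedSq c (S - N) + 2 := by
        have h3 : weightedSq z' (S - N) ≤ weightedSq c (S - N) + α ^ 2 / 16 := by
          rw [hr] at hcz'; linarith
        have h4 := mul_le_mul_of_nonneg_left h3 (show 0 ≤ 32 / α ^ 2 by positivity)
        have h5 : 32 / α ^ 2 * (α ^ 2 / 16) = 2 := by field_simp; norm_num
        rw [mul_add, h5] at h4
        exact h4
      have h3 : 1 ≤ α * lam⁻¹ + relEntropy z c / r ^ 2 := by
        rcases hor with hor | hor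
        · change lam = α at hor
          rw [hor, mul_inv_cancel₀ hα.ne']
          linarith [div_nonneg hrho0 (sq_nonneg r)]
        · change relEntropy z c = r ^ 2 at hor
          rw [hor, div_self (by positivity)]
          linarith [mul_pos hα (inv_pos.2 hlam0)]
      push_cast
      rw [add_div]
      linarith
  · push Not at hpass
    -- The model is corrected in the local norm at the midpoint `w`, where relative entropy
    -- controls the squared length of `z - c`; the potential is then compared at `c` and at `w`.
    set w := (1 / 2 : ℝ) • (z + c) with hw
    have hwi (i : ι) : w i = (z i + c i) / 2 := by
      simp only [hw, Pi.smul_apply, Pi.add_apply, smul_eq_mul]; ring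
    have hw0 (i : ι) : 0 < w i := by rw [hwi]; linarith [hz0 i, hc0 i]
    have hwm : w ∈ stdSimplex ℝ ι := by
      refine ⟨fun i => (hw0 i).le, ?_⟩
      simp_rw [hwi]
      rw [← Finset.sum_div, Finset.sum_add_distrib, hzm.2, hc.2]; norm_num
    have hwc : ∑ i, |w i - c i| ≤ r := by
      have (i : ι) : |w i - c i| = |z i - c i| / 2 := by
        rw [hwi, show (z i + c i) / 2 - c i = (z i - c i) / 2 by ring, abs_div, abs_two]
      simp_rw [this]
      rw [← Finset.sum_div]; linarith
    set N' := correctModel N h (z - c) w with hN'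
    have hN'1 : ∀ i j, |N' i j| ≤ 1 := abs_correctModel_le _ _ _ _
    have h1 := weightedSq_correctModel_le hS hS1 hw0 hh'
    have hdrop : α ^ 2 / 16 ≤ (∑ i, w i * h i ^ 2) / ∑ k, (z - c) k ^ 2 / w k := by
      set q := ∑ k, (z - c) k ^ 2 / w k with hq
      have hq4 : q ≤ 4 * relEntropy z c := by
        have := sum_sq_sub_div_le_relEntropy hzm hc hc0
        have e : q = 4 * ∑ i, (z i - c i) ^ 2 / (2 * (z i + c i)) := by
          rw [hq, Finset.mul_sum]
          refine Finset.sum_congr rfl fun i _ => ?_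
          have := (add_pos (hz0 i) (hc0 i)).ne'
          rw [hwi, Pi.sub_apply]; field_simp; norm_num
        linarith
      have hterm (i : ι) : 0 ≤ (z - c) i ^ 2 / w i := div_nonneg (sq_nonneg _) (hw0 i).le
      have hq0 : 0 < q := by
        refine (Finset.sum_nonneg fun i _ => hterm i).lt_of_ne fun h0 => ?_
        have hzc0 : z - c = 0 := by
          funext i
          have := (Finset.sum_eq_zero_iff_of_nonneg fun i _ => hterm i).1 h0.symm i
            (Finset.mem_univ i)
          simpa [(hw0 i).ne'] using this
        rw [hh', hzc0, Matrix.mulVec_zero] at hpass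
        simp only [Pi.zero_apply, ne_eq, OfNat.ofNat_ne_zero, not_false_eq_true, zero_pow,
          mul_zero, Finset.sum_const_zero] at hpass
        nlinarith [mul_nonneg (sq_nonneg lam) hrho0]
      have hH : (∑ i, z i * h i ^ 2) / 2 ≤ ∑ i, w i * h i ^ 2 := by
        rw [Finset.sum_div]
        refine Finset.sum_le_sum fun i _ => ?_
        rw [hwi]
        nlinarith [mul_nonneg (hc0 i).le (sq_nonneg (h i))]
      rw [le_div_iff₀ hq0]
      have h2 : α ^ 2 ≤ lam ^ 2 := pow_le_pow_left₀ hα.le hlam 2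
      have h3 : α ^ 2 * q ≤ lam ^ 2 * (4 * relEntropy z c) :=
        mul_le_mul h2 hq4 hq0.le (sq_nonneg _)
      linarith
    refine ⟨Q, hc, hc0, correctModel_transpose _ _ _ _, hN'1, hΛ, hQ, ⟨m, hm, hσ⟩, hreg, ?_⟩
    have h2 := weightedSq_le_add hwm hc (hD hN1)
    have h3 := weightedSq_le_add hc hwm (hD hN'1)
    simp_rw [abs_sub_comm (c _)] at h3
    have h4 : weightedSq c (S - N') ≤ weightedSq c (S - N) - α ^ 2 / 32 := by
      rw [hr] at hwc; linarith
    have h5 := mul_le_mul_of_nonneg_left h4 (show 0 ≤ 32 / α ^ 2 by positivity)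
    have h6 : 32 / α ^ 2 * (α ^ 2 / 32) = 1 := by field_simp
    rw [mul_sub, h6] at h5
    push_cast
    linarith

end Method

/-! ### Symmetrization and the oracle algorithm -/

section Oracle

variable {m n : ℕ}

/-- The payoff matrix, scaled by `1 / 2`, of the symmetrization of the game `A`: both players choose
a column and a row of `A`, and play `A` once in each role. -/
noncomputable def symmetrize (A : Matrix (Fin m) (Fin n) ℝ) :
    Matrix (Fin n × Fin m) (Fin n × Fin m) ℝ :=
  Matrix.of fun p q => (A q.2 p.1 - A p.2 q.1) / 2

/-- The marginals of a joint strategy. -/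
def marginals (z : Fin n × Fin m → ℝ) : (Fin n → ℝ) × (Fin m → ℝ) :=
  (fun j => ∑ i, z (j, i), fun i => ∑ j, z (j, i))

/-- The payoff vector in the symmetrized game of a joint strategy whose marginals `x` and `y` have
the oracle answers `u = A x` and `v = Aᵀ y`. -/
noncomputable def payoff (u : Fin m → ℝ) (v : Fin n → ℝ) : Fin n × Fin m → ℝ :=
  fun p => (v p.1 - u p.2) / 2

lemma symmetrize_transpose (A : Matrix (Fin m) (Fin n) ℝ) :
    (symmetrize A)ᵀ = -symmetrize A := by
  ext p q
  simp only [symmetrize, Matrix.transpose_apply, Matrix.neg_apply, Matrix.of_apply]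
  ring

lemma abs_symmetrize_le {A : Matrix (Fin m) (Fin n) ℝ} (hA : ∀ i j, |A i j| ≤ 1)
    (p q : Fin n × Fin m) : |symmetrize A p q| ≤ 1 := by
  rw [symmetrize, Matrix.of_apply, abs_div, abs_two, div_le_iff₀ two_pos]
  exact (abs_sub _ _).trans (by linarith [hA q.2 p.1, hA p.2 q.1])

lemma symmetrize_mulVec (A : Matrix (Fin m) (Fin n) ℝ) (z : Fin n × Fin m → ℝ) :
    symmetrize A *ᵥ z = payoff (A *ᵥ (marginals z).1) (Aᵀ *ᵥ (marginals z).2) := by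
  funext p
  simp only [symmetrize, payoff, marginals, Matrix.mulVec, dotProduct, Matrix.of_apply,
    Matrix.transpose_apply, Finset.mul_sum]
  rw [Finset.sum_comm (s := (Finset.univ : Finset (Fin m))), ← Finset.sum_sub_distrib,
    Fintype.sum_prod_type, Finset.sum_div]
  refine Finset.sum_congr rfl fun j _ => ?_
  rw [← Finset.sum_sub_distrib, Finset.sum_div]
  exact Finset.sum_congr rfl fun i _ => by ring

lemma marginals_mem {z : Fin n × Fin m → ℝ} (hz : z ∈ stdSimplex ℝ (Fin n × Fin m)) :
    (marginals z).1 ∈ stdSimplex ℝ (Fin n) ∧ (marginals z).2 ∈ stdSimplex ℝ (Fin m) := by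
  refine ⟨⟨fun j => ?_, ?_⟩, ⟨fun i => ?_, ?_⟩⟩
  · exact Finset.sum_nonneg (s := Finset.univ) fun i _ => hz.1 (j, i)
  · rw [← hz.2, Fintype.sum_prod_type]; rfl
  · exact Finset.sum_nonneg (s := Finset.univ) fun j _ => hz.1 (j, i)
  · rw [← hz.2, Fintype.sum_prod_type_right]; rfl

lemma payoff_dotProduct (u : Fin m → ℝ) (v : Fin n → ℝ) {x : Fin n → ℝ} {y : Fin m → ℝ}
    (hx : ∑ j, x j = 1) (hy : ∑ i, y i = 1) :
    payoff u v ⬝ᵥ (fun p => x p.1 * y p.2) = (x ⬝ᵥ v - y ⬝ᵥ u) / 2 := by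
  have h1 : ∑ p : Fin n × Fin m, x p.1 * v p.1 * y p.2 = x ⬝ᵥ v := by
    rw [Fintype.sum_prod_type]
    simp_rw [← Finset.mul_sum, hy, mul_one]
    rfl
  have h2 : ∑ p : Fin n × Fin m, y p.2 * u p.2 * x p.1 = y ⬝ᵥ u := by
    rw [Fintype.sum_prod_type_right]
    simp_rw [← Finset.mul_sum, hx, mul_one]
    rfl
  rw [← h1, ← h2, ← Finset.sum_sub_distrib, Finset.sum_div]
  exact Finset.sum_congr rfl fun p _ => by simp only [payoff]; ring

/-- The duality gap of the marginals is twice the largest loss of the joint strategy in the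
symmetrized game. -/
lemma isEpsSolution_marginals {A : Matrix (Fin m) (Fin n) ℝ} {ε : ℝ} {z : Fin n × Fin m → ℝ}
    (hz : z ∈ stdSimplex ℝ (Fin n × Fin m))
    (h : ∀ u ∈ stdSimplex ℝ (Fin n × Fin m), -((symmetrize A *ᵥ z) ⬝ᵥ u) ≤ ε / 2) :
    IsEpsSolution (stdSimplex ℝ (Fin n)) (stdSimplex ℝ (Fin m)) (bilin A) ε (marginals z) := by
  obtain ⟨hx, hy⟩ := marginals_mem hz
  refine ⟨hx, hy, ?_⟩
  set x := (marginals z).1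
  set y := (marginals z).2
  have key : ∀ x' ∈ stdSimplex ℝ (Fin n), ∀ y' ∈ stdSimplex ℝ (Fin m),
      bilin A x y' - bilin A x' y ≤ ε := by
    intro x' hx' y' hy'
    have hu : (fun p : Fin n × Fin m => x' p.1 * y' p.2) ∈ stdSimplex ℝ (Fin n × Fin m) := by
      refine ⟨fun p => mul_nonneg (hx'.1 _) (hy'.1 _), ?_⟩
      rw [Fintype.sum_prod_type]
      simp_rw [← Finset.mul_sum, hy'.2, mul_one, hx'.2]
    have h1 := h _ hu
    rw [symmetrize_mulVec, payoff_dotProduct _ _ hx'.2 hy'.2] at h1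
    have h2 : bilin A x' y = x' ⬝ᵥ (Aᵀ *ᵥ y) := by
      rw [bilin, Matrix.dotProduct_mulVec, dotProduct_comm, Matrix.mulVec_transpose]
    rw [h2]
    simp only [bilin]
    linarith
  rw [saddleGap, sub_le_comm]
  refine le_csInf (Set.Nonempty.image _ ⟨x, hx⟩) ?_
  rintro _ ⟨x', hx', rfl⟩
  rw [sub_le_iff_le_add]
  refine csSup_le (Set.Nonempty.image _ ⟨y, hy⟩) ?_
  rintro _ ⟨y', hy', rfl⟩
  exact sub_le_iff_le_add'.1 (by linarith [key x' hx' y' hy'])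

/-- The method on the symmetrization of the unknown matrix: `k` iterations from the state `s`,
each querying the center and then the proximal point. -/
noncomputable def run (α r : ℝ) :
    ℕ → State (Fin n × Fin m) → MatVecAlg m n ((Fin n → ℝ) × (Fin m → ℝ))
  | 0, s => .output (marginals (s.weight⁻¹ • s.sum))
  | k + 1, s =>
    .query (marginals s.center).1 (marginals s.center).2 fun u v =>
      let z := (proxStep α r s.center s.model (payoff u v)).2
      .query (marginals z).1 (marginals z).2 fun u' v' =>
        run α r k (s.next α r (payoff u v) (payoff u' v'))

lemma numQueries_run (A : Matrix (Fin m) (Fin n) ℝ) (α r : ℝ) (k : ℕ)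
    (s : State (Fin n × Fin m)) : (run α r k s).numQueries A = 2 * k := by
  induction k generalizing s with
  | zero => rfl
  | succ k ih => simp only [run, MatVecAlg.numQueries, ih]; ring

lemma exists_result_run [Nonempty (Fin n × Fin m)] {A : Matrix (Fin m) (Fin n) ℝ}
    (hA : ∀ i j, |A i j| ≤ 1) {α r : ℝ} (hα : 0 < α) (hα1 : α ≤ 1) (hr : r = α ^ 2 / 512)
    (k : ℕ) {l : ℕ} {Q : ℝ} {s : State (Fin n × Fin m)}
    (hs : Invariant (symmetrize A) α r l Q s) :
    ∃ Q' s', Invariant (symmetrize A) α r (l + k) Q' s' ∧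
      (run α r k s).result A = marginals (s'.weight⁻¹ • s'.sum) := by
  induction k generalizing l Q s with
  | zero => exact ⟨Q, s, hs, rfl⟩
  | succ k ih =>
    obtain ⟨Q₁, h₁⟩ := hs.next (symmetrize_transpose A) (abs_symmetrize_le hA) hα hα1 hr
    obtain ⟨Q', s', h', e⟩ := ih h₁
    refine ⟨Q', s', by convert h' using 1; ring, ?_⟩
    rw [← e]
    simp only [run, MatVecAlg.result, symmetrize_mulVec]

/-- The number of iterations that suffices for accuracy `δ` in a symmetric game with `N`
pure strategies. -/
noncomputable def numIter (N : ℕ) (α r δ : ℝ) : ℕ :=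
  ⌊3 * α / δ * Real.log N + 6 / r ^ 2 * Real.log N + 128 / α ^ 2⌋₊ + 1

/-- With `α = δ ^ (1 / 5)` and `r = α ^ 2 / 512`, both the number `α / δ` of steps with
regularization `α` and the number `r⁻²` of steps of length `r ^ 2` are, up to logarithms, of the
order of `δ ^ (-4 / 5)`; the bound is stated with the larger `δ ^ (-8 / 9)`. -/
lemma numIter_le {N : ℕ} {δ : ℝ} (hδ : 0 < δ) (hδ1 : δ ≤ 1) :
    (numIter N (δ ^ (1 / 5 : ℝ)) ((δ ^ (1 / 5 : ℝ)) ^ 2 / 512) δ : ℝ) ≤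
      δ ^ (-(8 / 9) : ℝ) * (1572867 * Real.log N + 129) := by
  set α := δ ^ (1 / 5 : ℝ) with hα
  have hα0 : 0 < α := by positivity
  have hα1 : α ≤ 1 := Real.rpow_le_one hδ.le hδ1 (by norm_num)
  have hα5 : δ = α ^ 5 := by
    rw [hα, ← Real.rpow_natCast, ← Real.rpow_mul hδ.le]; norm_num
  have hL : 0 ≤ Real.log N := Real.log_natCast_nonneg _
  have hpow : (α ^ 4)⁻¹ ≤ δ ^ (-(8 / 9) : ℝ) := by
    rw [hα, ← Real.rpow_natCast, ← Real.rpow_mul hδ.le, ← Real.rpow_neg hδ.le]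
    exact Real.rpow_le_rpow_of_exponent_ge hδ hδ1 (by norm_num)
  have h4 : α ^ 4 ≤ 1 := pow_le_one₀ hα0.le hα1
  have h42 : α ^ 4 ≤ α ^ 2 := pow_le_pow_of_le_one hα0.le hα1 (by norm_num)
  refine le_trans ?_ (mul_le_mul_of_nonneg_right hpow (by positivity))
  rw [numIter]
  push_cast
  have hfl := Nat.floor_le (a := 3 * α / δ * Real.log N + 6 / (α ^ 2 / 512) ^ 2 * Real.log N +
    128 / α ^ 2) (by positivity)
  have e1 : 3 * α / δ * Real.log N = (α ^ 4)⁻¹ * (3 * Real.log N) := by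
    rw [hα5]; field_simp
  have e2 : 6 / (α ^ 2 / 512) ^ 2 * Real.log N = (α ^ 4)⁻¹ * (1572864 * Real.log N) := by
    field_simp; ring
  have e3 : 128 / α ^ 2 ≤ (α ^ 4)⁻¹ * 128 := by
    rw [div_eq_inv_mul]; gcongr
  have e4 : 1 ≤ (α ^ 4)⁻¹ := (one_le_inv₀ (by positivity)).2 h4
  linarith

end Oracle

end SkewGame

open SkewGame

theorem theorem1 :
    ∃ alg : (m n : ℕ) → (ε : ℝ) → MatVecAlg m n ((Fin n → ℝ) × (Fin m → ℝ)),
      ∃ C : ℝ, 0 < C ∧ ∃ k : ℕ,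
        ∀ m n : ℕ, 0 < m → 0 < n → ∀ ε : ℝ, 0 < ε →
          ∀ A : Matrix (Fin m) (Fin n) ℝ, (∀ i j, |A i j| ≤ 1) →
            IsEpsSolution (stdSimplex ℝ (Fin n)) (stdSimplex ℝ (Fin m)) (bilin A) ε
                ((alg m n ε).result A) ∧
              ((alg m n ε).numQueries A : ℝ) ≤
                C * ε ^ (-(8 / 9) : ℝ) * Real.log ((m : ℝ) + (n : ℝ) + ε⁻¹) ^ k := by
  classical
  refine ⟨fun m n ε => if 2 ≤ ε then .output (marginals (State.init (Fin n × Fin m)).center) else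
    run ((ε / 2) ^ (1 / 5 : ℝ)) (((ε / 2) ^ (1 / 5 : ℝ)) ^ 2 / 512)
      (numIter (Fintype.card (Fin n × Fin m)) ((ε / 2) ^ (1 / 5 : ℝ))
        (((ε / 2) ^ (1 / 5 : ℝ)) ^ 2 / 512) (ε / 2)) (State.init _),
    13000000, by norm_num, 1, fun m n hm hn ε hε A hA => ?_⟩
  have : Nonempty (Fin n × Fin m) := ⟨(⟨0, hn⟩, ⟨0, hm⟩)⟩
  have hm1 : (1 : ℝ) ≤ m := by exact_mod_cast hm
  have hn1 : (1 : ℝ) ≤ n := by exact_mod_cast hn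
  have hε' : 0 < ε⁻¹ := inv_pos.2 hε
  set l := Real.log ((m : ℝ) + (n : ℝ) + ε⁻¹)
  have hl2 : 1 / 2 ≤ l := by
    have : Real.log 2 ≤ l := Real.log_le_log two_pos (by linarith)
    linarith [Real.log_two_gt_d9]
  dsimp only
  split_ifs with h2
  · refine ⟨isEpsSolution_marginals uniform_mem fun u hu => ?_, ?_⟩
    · have h1 := abs_dotProduct_le (v := u) fun i =>
        abs_dotProduct_le (v := (State.init (Fin n × Fin m)).center) (abs_symmetrize_le hA i)
      have h3 : (State.init (Fin n × Fin m)).center ∈ stdSimplex ℝ _ := uniform_mem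
      rw [sum_abs_eq_one hu, sum_abs_eq_one h3] at h1
      exact (neg_le_abs _).trans (h1.trans (by linarith))
    · have : 0 ≤ ε ^ (-(8 / 9) : ℝ) * l := by positivity
      simp only [MatVecAlg.numQueries, pow_one]
      push_cast
      linarith
  · push Not at h2
    set δ := ε / 2 with hδ
    have hδ0 : 0 < δ := by positivity
    have hδ1 : δ ≤ 1 := by linarith
    set α := δ ^ (1 / 5 : ℝ)
    have hα0 : 0 < α := by positivity
    have hα1 : α ≤ 1 := Real.rpow_le_one hδ0.le hδ1 (by norm_num)
    constructor
    · obtain ⟨Q, s, hs, e⟩ := exists_result_run hA hα0 hα1 rfl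
        (numIter (Fintype.card (Fin n × Fin m)) α (α ^ 2 / 512) δ)
        (Invariant.init (abs_symmetrize_le hA) α (α ^ 2 / 512))
      obtain ⟨h3, h4⟩ := hs.mean_spec (symmetrize_transpose A) hα0 hδ0 (by
        rw [zero_add, numIter]; exact_mod_cast Nat.lt_floor_add_one _)
      rw [e]
      exact isEpsSolution_marginals h3 h4
    · rw [numQueries_run, pow_one]
      push_cast
      have h3 := numIter_le (N := Fintype.card (Fin n × Fin m)) hδ0 hδ1
      have hcard : Real.log (Fintype.card (Fin n × Fin m) : ℕ) ≤ 2 * l := by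
        rw [Fintype.card_prod, Fintype.card_fin, Fintype.card_fin, Nat.cast_mul,
          Real.log_mul (by positivity) (by positivity)]
        have h4 : Real.log n ≤ l := Real.log_le_log (by positivity) (by linarith)
        have h5 : Real.log m ≤ l := Real.log_le_log (by positivity) (by linarith)
        linarith
      have hpow : δ ^ (-(8 / 9) : ℝ) ≤ 2 * ε ^ (-(8 / 9) : ℝ) := by
        rw [hδ, Real.div_rpow hε.le two_pos.le, Real.rpow_neg two_pos.le, div_inv_eq_mul, mul_comm]
        gcongr
        calc (2 : ℝ) ^ (8 / 9 : ℝ) ≤ 2 ^ (1 : ℝ) :=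
              Real.rpow_le_rpow_of_exponent_le one_le_two (by norm_num)
          _ = 2 := Real.rpow_one 2
      have h6 : δ ^ (-(8 / 9) : ℝ) * (1572867 * Real.log (Fintype.card (Fin n × Fin m) : ℕ) + 129)
          ≤ (2 * ε ^ (-(8 / 9) : ℝ)) * (3145992 * l) := by
        refine mul_le_mul hpow (by linarith) ?_ (by positivity)
        have := Real.log_natCast_nonneg (Fintype.card (Fin n × Fin m))
        positivity
      have h7 : 0 ≤ ε ^ (-(8 / 9) : ℝ) * l := by positivity
      linarith
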